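/- Let $(\Omega,\mathcal F,\mathbb F=(\mathcal F_t)_{t\ge 0},\mathbb P)$ be a filtered probability space, let $W$ be a standard Brownian motion and let $\Lambda$ be a subordinator (a Lévy process with $\Lambda_0=0$ and almost surely nondecreasing right-continuous paths) independent of $W$. Assume that for every $s\ge 0$ the increments $(\Lambda_{u}-\Lambda_s,\,W_{\Lambda_u}-W_{\Lambda_s})_{u\ge s}$ are independent of $\sigma\big(\mathcal F_s\cup\sigma(\Lambda_u:u\le s)\big)$ (when $\Lambda$ is adapted to $\mathbb F$, this says that the future increments of $(\Lambda,W_\Lambda)$ are independent of $\mathcal F_s$). Let $a\in\mathbb R$, $0\le t_0\le t$, let $y_0$ be an $\mathcal F_{t_0}$-measurable real random variable (for instance a constant), and let $Y$ be a càdlàg process on $[t_0,\infty)$ solving $$dY_r=-aY_{r-}\,dr+dW_{\Lambda_r},\qquad Y_{t_0}=y_0,$$ that is, almost surely, $Y_r=y_0-a\int_{t_0}^r Y_{s-}\,ds+W_{\Lambda_r}-W_{\Lambda_{t_0}}$ for all $r\ge t_0$. Put $\mathcal G_{t_0,t}=\sigma\big(\mathcal F_{t_0}\cup\sigma(\Lambda_u:u\le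 t)\big)$. Then $$Y_t\,\big|\,\mathcal G_{t_0,t}\ \sim\ N\Big(y_0e^{-a(t-t_0)},\ \int_{(t_0,t]}e^{-2a(t-u)}\,d\Lambda_u\Big),$$ where the integral is a pathwise Lebesgue–Stieltjes integral: for every Borel set $B\subseteq\mathbb R$, $\mathbb P(Y_t\in B\mid\mathcal G_{t_0,t})$ equals almost surely the mass that this (possibly degenerate) normal law gives to $B$. -/

import Mathlib

open MeasureTheory ProbabilityTheory Set
open scoped NNReal

noncomputable section

variable {Ω : Type*} {mΩ : MeasurableSpace Ω}

/-- A subordinator: a real Lévy process, started at `0`, whose paths are almost surely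
nondecreasing (and right-continuous; left limits exist by monotonicity). -/
structure IsSubordinator (Λ : ℝ≥0 → Ω → ℝ≥0) (P : Measure Ω) : Prop where
  measurable : ∀ t, Measurable (Λ t)
  zero : ∀ᵐ ω ∂P, Λ 0 ω = 0
  indep_increments : HasIndepIncrements (fun t ω ↦ (Λ t ω : ℝ)) P
  stationary_increments : ∀ s t : ℝ≥0,
    IdentDistrib (fun ω ↦ (Λ (s + t) ω : ℝ) - Λ s ω) (fun ω ↦ (Λ t ω : ℝ)) P P
  monotone : ∀ᵐ ω ∂P, Monotone (fun t ↦ Λ t ω)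
  right_continuous : ∀ᵐ ω ∂P, ∀ t, ContinuousWithinAt (fun s ↦ Λ s ω) (Ici t) t

/-- The process `t ↦ W_{Λ_t}`. -/
def timeChanged (W : ℝ≥0 → Ω → ℝ) (Λ : ℝ≥0 → Ω → ℝ≥0) (t : ℝ≥0) (ω : Ω) : ℝ :=
  W (Λ t ω) ω

/-- The σ-field generated by `Λ_u`, `u ≤ t`. -/
@[reducible]
def pastSigma (Λ : ℝ≥0 → Ω → ℝ≥0) (t : ℝ≥0) : MeasurableSpace Ω :=
  ⨆ u : ℝ≥0, ⨆ _ : u ≤ t, MeasurableSpace.comap (Λ u) inferInstance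

/-- The σ-field generated by the increments of the pair `(Λ, W_Λ)` after time `s`. -/
@[reducible]
def futureIncrementSigma (W : ℝ≥0 → Ω → ℝ) (Λ : ℝ≥0 → Ω → ℝ≥0) (s : ℝ≥0) :
    MeasurableSpace Ω :=
  ⨆ h : ℝ≥0, MeasurableSpace.comap
    (fun ω ↦ ((Λ (s + h) ω : ℝ) - Λ s ω,
      timeChanged W Λ (s + h) ω - timeChanged W Λ s ω)) inferInstance

/-- The filtration does not look ahead: at each time `s`, the later increments of `(Λ, W_Λ)` are
independent of the information in `ℱ_s` and in the past of `Λ`. When `Λ` is adapted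
to `ℱ`, the σ-field on the right is `ℱ_s`. -/
def IsNonanticipating (ℱ : Filtration ℝ≥0 mΩ) (W : ℝ≥0 → Ω → ℝ) (Λ : ℝ≥0 → Ω → ℝ≥0)
    (P : Measure Ω) : Prop :=
  ∀ s : ℝ≥0, Indep (futureIncrementSigma W Λ s) (ℱ s ⊔ pastSigma Λ s) P

/-- `Y` solves `dY_t = -a Y_{t-} dt + dL_t` on `[t₀, ∞)` with `Y_{t₀} = y₀`: almost surely, the
path is càdlàg on `[t₀, ∞)` and satisfies the integrated equation at all times `t ≥ t₀`. -/
structure IsOUSolution (a : ℝ) (L : ℝ≥0 → Ω → ℝ) (t₀ : ℝ≥0) (y₀ : Ω → ℝ)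
    (Y : ℝ≥0 → Ω → ℝ) (P : Measure Ω) : Prop where
  initial : ∀ᵐ ω ∂P, Y t₀ ω = y₀ ω
  right_continuous : ∀ᵐ ω ∂P, ∀ t, t₀ ≤ t → ContinuousWithinAt (fun s ↦ Y s ω) (Ici t) t
  left_limits : ∀ᵐ ω ∂P, ∀ t, t₀ < t →
    ∃ l : ℝ, Filter.Tendsto (fun s ↦ Y s ω) (nhdsWithin t (Iio t)) (nhds l)
  equation : ∀ᵐ ω ∂P, ∀ t, t₀ ≤ t →
    Y t ω = Y t₀ ω + (∫ s in (t₀ : ℝ)..(t : ℝ), -a * Function.leftLim (fun r ↦ Y r ω) s.toNNReal)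
      + (L t ω - L t₀ ω)

open scoped Classical in
/-- The Lebesgue-Stieltjes measure `df` on `[0, ∞)` of a nondecreasing right-continuous path `f`,
giving mass `f v - f u` to `(u, v]` (and `0` if `f` is not monotone). -/
def stieltjesOfPath (f : ℝ≥0 → ℝ) : Measure ℝ≥0 :=
  if hf : Monotone f then hf.stieltjesFunction.measure else 0

/-- `∫_{(t₀, t]} e^{-2a(t-u)} dΛ_u`, computed path by path. -/
def ouVariance (a : ℝ) (Λ : ℝ≥0 → Ω → ℝ≥0) (t₀ t : ℝ≥0) (ω : Ω) : ℝ :=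
  ∫ u in Ioc t₀ t, Real.exp (-2 * a * ((t : ℝ) - u)) ∂(stieltjesOfPath fun s ↦ (Λ s ω : ℝ))

/-- The random measure `κ` is the conditional law of `X` given the sub-σ-field `𝒢`. -/
structure IsCondLaw (P : Measure Ω) (X : Ω → ℝ) (𝒢 : MeasurableSpace Ω)
    (κ : Ω → Measure ℝ) : Prop where
  le : 𝒢 ≤ mΩ
  aemeasurable : AEMeasurable X P
  condProb : ∀ B : Set ℝ, MeasurableSet B → P⟦X ⁻¹' B | 𝒢⟧ =ᵐ[P] fun ω ↦ (κ ω).real B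

end

/-! Pathwise, variation of constants gives `Y_t = y₀ e^{-a(t-t₀)} + ∫ e^{-a(t-u)} dW_{Λ_u}`, the
integral being a limit of Riemann sums along uniform partitions (`tendsto_ouSum`). No stochastic
integration is needed, because the kernel is smooth and summation by parts moves the increments onto
it.

Given the path of `Λ`, each Riemann sum is a weighted sum of Brownian increments over the ordered
times `Λ_{r_k}`. It is therefore centred Gaussian, with variance the weighted sum of the increments
of `Λ` with squared weights. In Fourier form this is `integral_cexp_weightedIncr_timeChanged`, and
the variances converge to the Stieltjes integral (`tendsto_ouVarianceSum`).

To condition on `ℱ_{t₀}` as well, the σ-field is split at `t₀` (`sup_pastSigma_eq`) into information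
up to `t₀` and increments of `Λ` after `t₀`. The increments of `(Λ, W_Λ)` after `t₀` are independent
of the former, so the Fourier identity holds on every intersection `A ∩ B` of events from the two
factors (`setIntegral_cexp_weightedIncr`). Dominated convergence carries it to `Y_t`. Injectivity of
the characteristic function and a π-λ argument then identify the conditional law
(`condProb_ae_eq_of_charFun`). -/

open Filter Topology

/-! ### Uniform partitions and Riemann sums. -/

/-- The `k`-th point of the uniform partition of `[t₀, t]` into `n + 1` cells. -/
noncomputable def uniformGrid (t₀ t : ℝ≥0) (n k : ℕ) : ℝ≥0 := t₀ + (t - t₀) * (k / (n + 1))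

lemma uniformGrid_zero (t₀ t : ℝ≥0) (n : ℕ) : uniformGrid t₀ t n 0 = t₀ := by
  simp [uniformGrid]

lemma uniformGrid_last {t₀ t : ℝ≥0} (h : t₀ ≤ t) (n : ℕ) : uniformGrid t₀ t n (n + 1) = t := by
  simp [uniformGrid, h]

lemma uniformGrid_mono (t₀ t : ℝ≥0) (n : ℕ) : Monotone (uniformGrid t₀ t n) := by
  intro i j hij
  unfold uniformGrid
  gcongr

lemma uniformGrid_mem_Icc {t₀ t : ℝ≥0} (h : t₀ ≤ t) {n k : ℕ} (hk : k ≤ n + 1) :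
    uniformGrid t₀ t n k ∈ Icc t₀ t :=
  ⟨by simp [uniformGrid], by simpa [uniformGrid_last h] using uniformGrid_mono t₀ t n hk⟩

lemma uniformGrid_succ (t₀ t : ℝ≥0) (n k : ℕ) :
    uniformGrid t₀ t n (k + 1) = uniformGrid t₀ t n k + (t - t₀) / (n + 1) := by
  simp only [uniformGrid]; push_cast; ring

/-- The step function on the uniform partition with value `φ u v` on the cell `(u, v]`. -/
noncomputable def gridStep (t₀ t : ℝ≥0) (φ : ℝ≥0 → ℝ≥0 → ℝ) (n : ℕ) (s : ℝ≥0) : ℝ :=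
  ∑ k ∈ Finset.range (n + 1), (Ioc (uniformGrid t₀ t n k) (uniformGrid t₀ t n (k + 1))).indicator
    (fun _ ↦ φ (uniformGrid t₀ t n k) (uniformGrid t₀ t n (k + 1))) s

lemma measurable_gridStep (t₀ t : ℝ≥0) (φ : ℝ≥0 → ℝ≥0 → ℝ) (n : ℕ) :
    Measurable (gridStep t₀ t φ n) :=
  Finset.measurable_sum _ fun _ _ ↦ measurable_const.indicator measurableSet_Ioc

lemma exists_gridCell {t₀ t : ℝ≥0} (h : t₀ ≤ t) {s : ℝ≥0} (hs : s ∈ Ioc t₀ t) (n : ℕ) :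
    ∃ k < n + 1, s ∈ Ioc (uniformGrid t₀ t n k) (uniformGrid t₀ t n (k + 1)) := by
  by_contra! H
  have : ∀ k ≤ n + 1, uniformGrid t₀ t n k < s := by
    intro k
    induction k with
    | zero => intro _; rw [uniformGrid_zero]; exact hs.1
    | succ k ih =>
      intro hk
      have h1 := H k (by omega)
      by_contra! h2
      exact h1 ⟨ih (by omega), h2⟩
  have := this (n + 1) le_rfl
  rw [uniformGrid_last h] at this
  exact absurd hs.2 (not_le.2 this)

lemma gridStep_of_mem (t₀ t : ℝ≥0) (φ : ℝ≥0 → ℝ≥0 → ℝ) {n k : ℕ} (hk : k < n + 1) {s : ℝ≥0}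
    (hs : s ∈ Ioc (uniformGrid t₀ t n k) (uniformGrid t₀ t n (k + 1))) :
    gridStep t₀ t φ n s = φ (uniformGrid t₀ t n k) (uniformGrid t₀ t n (k + 1)) := by
  unfold gridStep
  rw [Finset.sum_eq_single k, indicator_of_mem hs]
  · intro j _ hj
    refine indicator_of_notMem (fun hs' ↦ ?_) _
    have := (uniformGrid_mono t₀ t n).pairwise_disjoint_on_Ioc_succ hj
    exact Set.disjoint_left.1 this (by simpa using hs') (by simpa using hs)
  · intro hk'; exact absurd (Finset.mem_range.2 hk) hk'

/-- The cell `(u, v]` containing `s` shrinks to `s` with `u < s ≤ v`. The strict inequality on the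
left is what makes left endpoint values converge to left limits. -/
lemma tendsto_gridStep {t₀ t : ℝ≥0} (h : t₀ ≤ t) {φ : ℝ≥0 → ℝ≥0 → ℝ} {s : ℝ≥0}
    (hs : s ∈ Ioc t₀ t) {l : ℝ}
    (hφ : Tendsto (Function.uncurry φ) (𝓝[<] s ×ˢ 𝓝[≥] s) (𝓝 l)) :
    Tendsto (fun n ↦ gridStep t₀ t φ n s) atTop (𝓝 l) := by
  choose k hk hsk using exists_gridCell h hs
  have hmesh : Tendsto (fun n : ℕ ↦ (t - t₀) / ((n : ℝ≥0) + 1)) atTop (𝓝 0) := by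
    rw [← NNReal.tendsto_coe]
    simp only [NNReal.coe_div, NNReal.coe_add, NNReal.coe_natCast, NNReal.coe_one, NNReal.coe_zero]
    exact tendsto_const_nhds.div_atTop
      (tendsto_atTop_add_const_right _ _ tendsto_natCast_atTop_atTop)
  have hu : Tendsto (fun n ↦ uniformGrid t₀ t n (k n)) atTop (𝓝[<] s) := by
    refine tendsto_nhdsWithin_iff.2 ⟨?_, Eventually.of_forall fun n ↦ (hsk n).1⟩
    have h1 : Tendsto (fun n : ℕ ↦ s - (t - t₀) / ((n : ℝ≥0) + 1)) atTop (𝓝 s) := by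
      simpa using hmesh.const_sub s
    refine tendsto_of_tendsto_of_tendsto_of_le_of_le h1 tendsto_const_nhds ?_ fun n ↦ (hsk n).1.le
    intro n
    have := (hsk n).2
    rw [uniformGrid_succ] at this
    exact tsub_le_iff_right.2 this
  have hv : Tendsto (fun n ↦ uniformGrid t₀ t n (k n + 1)) atTop (𝓝[≥] s) := by
    refine tendsto_nhdsWithin_iff.2 ⟨?_, Eventually.of_forall fun n ↦ (hsk n).2⟩
    have h1 : Tendsto (fun n : ℕ ↦ s + (t - t₀) / ((n : ℝ≥0) + 1)) atTop (𝓝 s) := by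
      simpa using hmesh.const_add s
    refine tendsto_of_tendsto_of_tendsto_of_le_of_le tendsto_const_nhds h1 (fun n ↦ (hsk n).2) ?_
    intro n
    change uniformGrid t₀ t n (k n + 1) ≤ _
    rw [uniformGrid_succ]
    exact add_le_add (hsk n).1.le le_rfl
  refine (hφ.comp (hu.prodMk hv)).congr fun n ↦ ?_
  simp [gridStep_of_mem t₀ t φ (hk n) (hsk n)]

lemma abs_gridStep_le {t₀ t : ℝ≥0} (h : t₀ ≤ t) {φ : ℝ≥0 → ℝ≥0 → ℝ} {C : ℝ}
    (hC : ∀ u ∈ Icc t₀ t, ∀ v ∈ Icc t₀ t, |φ u v| ≤ C) {s : ℝ≥0} (hs : s ∈ Ioc t₀ t) (n : ℕ) :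
    |gridStep t₀ t φ n s| ≤ C := by
  obtain ⟨k, hk, hsk⟩ := exists_gridCell h hs n
  rw [gridStep_of_mem t₀ t φ hk hsk]
  exact hC _ (uniformGrid_mem_Icc h (by omega)) _ (uniformGrid_mem_Icc h (by omega))

/-- Riemann sums along the uniform partition converge to the integral. -/
lemma tendsto_gridSum {α : Type*} [MeasurableSpace α] {ν : Measure α} {τ : α → ℝ≥0}
    (hτ : Measurable τ) {t₀ t : ℝ≥0} (h : t₀ ≤ t) {φ : ℝ≥0 → ℝ≥0 → ℝ} {C : ℝ}
    (hC : ∀ u ∈ Icc t₀ t, ∀ v ∈ Icc t₀ t, |φ u v| ≤ C) {G : ℝ≥0 → ℝ}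
    (hφ : ∀ s ∈ Ioc t₀ t, Tendsto (Function.uncurry φ) (𝓝[<] s ×ˢ 𝓝[≥] s) (𝓝 (G s)))
    {f : α → ℝ} (hf : IntegrableOn f (τ ⁻¹' Ioc t₀ t) ν) :
    Tendsto (fun n ↦ ∑ k ∈ Finset.range (n + 1),
      φ (uniformGrid t₀ t n k) (uniformGrid t₀ t n (k + 1)) *
        ∫ x in τ ⁻¹' Ioc (uniformGrid t₀ t n k) (uniformGrid t₀ t n (k + 1)), f x ∂ν)
      atTop (𝓝 (∫ x in τ ⁻¹' Ioc t₀ t, G (τ x) * f x ∂ν)) := by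
  have key : ∀ n, ∑ k ∈ Finset.range (n + 1),
      φ (uniformGrid t₀ t n k) (uniformGrid t₀ t n (k + 1)) *
        ∫ x in τ ⁻¹' Ioc (uniformGrid t₀ t n k) (uniformGrid t₀ t n (k + 1)), f x ∂ν
      = ∫ x in τ ⁻¹' Ioc t₀ t, gridStep t₀ t φ n (τ x) * f x ∂ν := by
    intro n
    have hsub : ∀ k ∈ Finset.range (n + 1), τ ⁻¹' Ioc (uniformGrid t₀ t n k)
        (uniformGrid t₀ t n (k + 1)) ⊆ τ ⁻¹' Ioc t₀ t := by
      intro k hk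
      have hk := Finset.mem_range.1 hk
      exact preimage_mono (Ioc_subset_Ioc (uniformGrid_mem_Icc h (by omega)).1
        (uniformGrid_mem_Icc h (by omega)).2)
    have hpt : ∀ x, gridStep t₀ t φ n (τ x) * f x = ∑ k ∈ Finset.range (n + 1),
        (τ ⁻¹' Ioc (uniformGrid t₀ t n k) (uniformGrid t₀ t n (k + 1))).indicator
          (fun x ↦ φ (uniformGrid t₀ t n k) (uniformGrid t₀ t n (k + 1)) * f x) x := by
      intro x
      rw [gridStep, Finset.sum_mul]
      refine Finset.sum_congr rfl fun k _ ↦ ?_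
      simp only [indicator, mem_preimage]
      split_ifs <;> simp
    simp_rw [hpt]
    rw [integral_finsetSum]
    · refine Finset.sum_congr rfl fun k hk ↦ ?_
      rw [setIntegral_indicator (hτ measurableSet_Ioc), inter_eq_right.2 (hsub k hk),
        integral_const_mul]
    · intro k hk
      exact (Integrable.const_mul hf _).indicator (hτ measurableSet_Ioc)
  simp_rw [key]
  refine tendsto_integral_of_dominated_convergence (fun x ↦ C * |f x|) ?_ ?_ ?_ ?_
  · exact fun n ↦ ((measurable_gridStep t₀ t φ n).comp hτ).aestronglyMeasurable.mul hf.1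
  · exact (Integrable.abs hf).const_mul C
  · intro n
    refine (ae_restrict_iff' (hτ measurableSet_Ioc)).2 (ae_of_all _ fun x hx ↦ ?_)
    rw [Real.norm_eq_abs, abs_mul]
    gcongr
    exact abs_gridStep_le h hC hx n
  · refine (ae_restrict_iff' (hτ measurableSet_Ioc)).2 (ae_of_all _ fun x hx ↦ ?_)
    exact (tendsto_gridStep h hx (hφ _ hx)).mul_const _

/-! ### Càdlàg paths and the variation-of-constants formula. -/

/-- One-sided limits bound the path near each point, and compactness makes the bound uniform. -/
lemma exists_bound_of_cadlag {y : ℝ≥0 → ℝ} {t₀ t : ℝ≥0}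
    (hr : ∀ s, t₀ ≤ s → ContinuousWithinAt y (Ici s) s)
    (hl : ∀ s, t₀ < s → ∃ l : ℝ, Tendsto y (𝓝[<] s) (𝓝 l)) :
    ∃ C : ℝ, ∀ u ∈ Icc t₀ t, |y u| ≤ C := by
  refine isCompact_Icc.induction_on (p := fun s ↦ ∃ C : ℝ, ∀ u ∈ s, |y u| ≤ C) ⟨0, by simp⟩ ?_ ?_ ?_
  · rintro s s' hss ⟨C, hC⟩
    exact ⟨C, fun u hu ↦ hC u (hss hu)⟩
  · rintro s s' ⟨C, hC⟩ ⟨C', hC'⟩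
    refine ⟨max C C', fun u hu ↦ ?_⟩
    rcases hu with hu | hu
    · exact (hC u hu).trans (le_max_left _ _)
    · exact (hC' u hu).trans (le_max_right _ _)
  · intro x hx
    have bd : ∀ {F : Filter ℝ≥0} {l : ℝ}, Tendsto y F (𝓝 l) →
        ∀ᶠ u in F, |y u| ≤ |l| + 1 := fun hF ↦
      (hF.abs.eventually_lt_const (lt_add_one _)).mono fun _ hu ↦ hu.le
    have h1 := bd (hr x hx.1)
    rcases hx.1.eq_or_lt with rfl | hlt
    · exact ⟨_, mem_of_superset h1 (fun u hu ↦ hu) |> fun h ↦ nhdsWithin_mono _ Icc_subset_Ici_self h,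
        |y t₀| + 1, fun u hu ↦ hu⟩
    · obtain ⟨l, hl⟩ := hl x hlt
      have h2 := bd hl
      refine ⟨{u | |y u| ≤ max (|y x| + 1) (|l| + 1)}, ?_, _, fun u hu ↦ hu⟩
      refine mem_nhdsWithin_of_mem_nhds ?_
      rw [← nhdsLT_sup_nhdsGE]
      exact ⟨h2.mono fun u hu ↦ hu.trans (le_max_right _ _),
        h1.mono fun u hu ↦ hu.trans (le_max_left _ _)⟩

lemma toNNReal_preimage_Ioc (u v : ℝ≥0) :
    Real.toNNReal ⁻¹' Ioc u v = Ioc (u : ℝ) v := by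
  ext x
  simp [Real.lt_toNNReal_iff_coe_lt, Real.toNNReal_le_iff_le_coe]

/-- Measurability comes from writing the left limits as a pointwise limit of step functions with
left endpoint values; the bound on the path passes to the limit. -/
lemma integrableOn_leftLim {y : ℝ≥0 → ℝ} {t₀ t : ℝ≥0} (h : t₀ ≤ t)
    (hr : ∀ s, t₀ ≤ s → ContinuousWithinAt y (Ici s) s)
    (hl : ∀ s, t₀ < s → ∃ l : ℝ, Tendsto y (𝓝[<] s) (𝓝 l)) :
    IntegrableOn (fun x : ℝ ↦ Function.leftLim y x.toNNReal) (Real.toNNReal ⁻¹' Ioc t₀ t) := by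
  obtain ⟨C, hC⟩ := exists_bound_of_cadlag (t := t) hr hl
  have hlim : ∀ᵐ x ∂(volume.restrict (Real.toNNReal ⁻¹' Ioc t₀ t)),
      Tendsto (fun n ↦ gridStep t₀ t (fun u _ ↦ y u) n (Real.toNNReal x)) atTop
        (𝓝 (Function.leftLim y x.toNNReal)) :=
    (ae_restrict_iff' (measurable_real_toNNReal measurableSet_Ioc)).2
      (ae_of_all _ fun x hx ↦ tendsto_gridStep h hx
        ((tendsto_leftLim_of_tendsto (hl _ hx.1)).comp tendsto_fst))
  have hfin : volume (Real.toNNReal ⁻¹' Ioc t₀ t) < ⊤ := by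
    rw [toNNReal_preimage_Ioc]; exact measure_Ioc_lt_top
  refine IntegrableOn.of_bound hfin (aestronglyMeasurable_of_tendsto_ae atTop
    (fun n ↦ ((measurable_gridStep t₀ t _ n).comp
      measurable_real_toNNReal).aestronglyMeasurable) hlim) C ?_
  filter_upwards [hlim, ae_restrict_mem (measurable_real_toNNReal measurableSet_Ioc)] with x hx hm
  exact le_of_tendsto hx.norm (Eventually.of_forall fun n ↦
    abs_gridStep_le h (fun u hu _ _ ↦ hC u hu) hm n)

lemma tendsto_exp_kernel (a : ℝ) (t s : ℝ≥0) :
    Tendsto (fun v : ℝ≥0 ↦ Real.exp (-a * ((t : ℝ) - v))) (𝓝[≥] s)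
      (𝓝 (Real.exp (-a * ((t : ℝ) - s)))) :=
  (Continuous.tendsto (by fun_prop) s).mono_left nhdsWithin_le_nhds

lemma abs_exp_kernel_le (a : ℝ) {t v : ℝ≥0} (hv : v ≤ t) :
    |Real.exp (-a * ((t : ℝ) - v))| ≤ Real.exp (|a| * t) := by
  have hv' : (v : ℝ) ≤ t := by exact_mod_cast hv
  rw [abs_of_pos (Real.exp_pos _), Real.exp_le_exp]
  have := neg_le_abs a
  have := abs_nonneg a
  nlinarith [v.coe_nonneg]

/-- The solution of the linear equation with càdlàg driver `ℓ` is the limit of the Riemann sums of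
the variation-of-constants formula. -/
lemma tendsto_ouSum (a : ℝ) {y ℓ : ℝ≥0 → ℝ} {t₀ t : ℝ≥0} (h : t₀ ≤ t)
    (hr : ∀ s, t₀ ≤ s → ContinuousWithinAt y (Ici s) s)
    (hl : ∀ s, t₀ < s → ∃ l : ℝ, Tendsto y (𝓝[<] s) (𝓝 l))
    (heq : ∀ s, t₀ ≤ s → y s = y t₀
      + (∫ r in (t₀ : ℝ)..(s : ℝ), -a * Function.leftLim y r.toNNReal) + (ℓ s - ℓ t₀)) :
    Tendsto (fun n ↦ ∑ k ∈ Finset.range (n + 1),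
      Real.exp (-a * ((t : ℝ) - uniformGrid t₀ t n (k + 1))) *
        (ℓ (uniformGrid t₀ t n (k + 1)) - ℓ (uniformGrid t₀ t n k)))
      atTop (𝓝 (y t - y t₀ * Real.exp (-a * ((t : ℝ) - t₀)))) := by
  set g : ℝ≥0 → ℝ := fun s ↦ Real.exp (-a * ((t : ℝ) - s)) with hg
  obtain ⟨C, hC⟩ := exists_bound_of_cadlag (t := t) hr hl
  have hcont : Continuous fun x : ℝ ↦ Real.exp (-a * ((t : ℝ) - x)) := by fun_prop
  have hI := integrableOn_leftLim h hr hl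
  have hgI : IntegrableOn (fun x : ℝ ↦ a * Real.exp (-a * ((t : ℝ) - x)))
      (Real.toNNReal ⁻¹' Ioc t₀ t) := by
    rw [toNNReal_preimage_Ioc]
    exact ((hcont.const_mul a).intervalIntegrable (t₀ : ℝ) t).1
  -- Since `g' = a g`, summation by parts leaves two error sums: `y(u) ∫ a g` and `a g(v) ∫ y₋` over
  -- the cells `(u, v]`. Both tend to `∫ a g y₋`, so their difference vanishes.
  have lim1 := tendsto_gridSum (ν := volume) measurable_real_toNNReal h
    (φ := fun u _ ↦ y u) (fun u hu _ _ ↦ hC u hu) (G := Function.leftLim y)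
    (fun s hs ↦ (tendsto_leftLim_of_tendsto (hl s hs.1)).comp tendsto_fst) hgI
  have lim2 := tendsto_gridSum (ν := volume) measurable_real_toNNReal h
    (φ := fun _ v ↦ a * g v) (C := |a| * Real.exp (|a| * t)) (fun _ _ v hv ↦ by
      rw [abs_mul]; gcongr; exact abs_exp_kernel_le a hv.2) (G := fun s ↦ a * g s)
    (fun s hs ↦ ((tendsto_exp_kernel a t s).const_mul a).comp tendsto_snd) hI
  have hlimeq : ∫ x in Real.toNNReal ⁻¹' Ioc t₀ t, Function.leftLim y x.toNNReal *
        (a * Real.exp (-a * ((t : ℝ) - x)))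
      = ∫ x in Real.toNNReal ⁻¹' Ioc t₀ t, (a * g x.toNNReal) *
        Function.leftLim y x.toNNReal := by
    refine setIntegral_congr_fun (measurable_real_toNNReal measurableSet_Ioc) fun x hx ↦ ?_
    rw [toNNReal_preimage_Ioc] at hx
    have : ((x.toNNReal : ℝ≥0) : ℝ) = x :=
      Real.coe_toNNReal _ (t₀.coe_nonneg.trans hx.1.le)
    simp only [hg, this]
    ring
  have lim := (lim2.sub lim1).const_add (y t - y t₀ * g t₀)
  rw [← hlimeq, sub_self, add_zero] at lim
  refine lim.congr fun n ↦ ?_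
  set r := uniformGrid t₀ t n with hrdef
  have hmono := uniformGrid_mono t₀ t n
  have hmem : ∀ k ≤ n + 1, r k ∈ Icc t₀ t := fun k hk ↦ uniformGrid_mem_Icc h hk
  have hII : ∀ k ≤ n + 1, IntervalIntegrable (fun x : ℝ ↦ -a * Function.leftLim y x.toNNReal)
      volume t₀ (r k) := by
    intro k hk
    rw [intervalIntegrable_iff_integrableOn_Ioc_of_le (by exact_mod_cast (hmem k hk).1),
      ← toNNReal_preimage_Ioc]
    exact (IntegrableOn.mono_set hI (preimage_mono (Ioc_subset_Ioc_right (hmem k hk).2))).const_mul _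
  have hℓ : ∀ k < n + 1, ℓ (r (k + 1)) - ℓ (r k) = y (r (k + 1)) - y (r k) +
      a * ∫ x in Real.toNNReal ⁻¹' Ioc (r k) (r (k + 1)), Function.leftLim y x.toNNReal := by
    intro k hk
    have e1 := heq _ (hmem k (by omega)).1
    have e2 := heq _ (hmem (k + 1) (by omega)).1
    have e3 := intervalIntegral.integral_interval_sub_left (hII (k + 1) (by omega))
      (hII k (by omega))
    have hle : (r k : ℝ) ≤ r (k + 1) := by exact_mod_cast hmono (Nat.le_succ k)
    rw [intervalIntegral.integral_of_le hle, ← toNNReal_preimage_Ioc, integral_const_mul] at e3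
    linarith
  have hgk : ∀ k, ∫ x in Real.toNNReal ⁻¹' Ioc (r k) (r (k + 1)),
      a * Real.exp (-a * ((t : ℝ) - x)) = g (r (k + 1)) - g (r k) := by
    intro k
    have hle : (r k : ℝ) ≤ r (k + 1) := by exact_mod_cast hmono (Nat.le_succ k)
    rw [toNNReal_preimage_Ioc, ← intervalIntegral.integral_of_le hle]
    refine intervalIntegral.integral_eq_sub_of_hasDerivAt
      (f := fun x ↦ Real.exp (-a * ((t : ℝ) - x))) (fun x _ ↦ ?_)
      ((hcont.const_mul a).intervalIntegrable _ _)
    have := (((hasDerivAt_id' x).const_sub (t : ℝ)).const_mul (-a)).exp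
    exact this.congr_deriv (by ring)
  have htel : ∑ k ∈ Finset.range (n + 1), (y (r (k + 1)) * g (r (k + 1)) - y (r k) * g (r k))
      = y t - y t₀ * g t₀ := by
    rw [Finset.sum_range_sub (fun k ↦ y (r k) * g (r k)), hrdef, uniformGrid_last h,
      uniformGrid_zero]
    simp [hg]
  rw [← htel, ← Finset.sum_sub_distrib, ← Finset.sum_add_distrib]
  refine Finset.sum_congr rfl fun k hk ↦ ?_
  rw [hℓ k (Finset.mem_range.1 hk)]
  simp only [hgk]
  change _ = g (r (k + 1)) * _
  ring

/-! ### The variance as a Lebesgue–Stieltjes integral. -/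

lemma stieltjesOfPath_Ioc {f : ℝ≥0 → ℝ} (hf : Monotone f)
    (hr : ∀ s, ContinuousWithinAt f (Ici s) s) (u v : ℝ≥0) :
    stieltjesOfPath f (Ioc u v) = ENNReal.ofReal (f v - f u) := by
  rw [stieltjesOfPath, dif_pos hf, StieltjesFunction.measure_Ioc, hf.stieltjesFunction_eq,
    hf.stieltjesFunction_eq, (hr u).rightLim_eq, (hr v).rightLim_eq]

lemma tendsto_ouVarianceSum (a : ℝ) {f : ℝ≥0 → ℝ} (hf : Monotone f)
    (hr : ∀ s, ContinuousWithinAt f (Ici s) s) {t₀ t : ℝ≥0} (h : t₀ ≤ t) :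
    Tendsto (fun n ↦ ∑ k ∈ Finset.range (n + 1),
      Real.exp (-a * ((t : ℝ) - uniformGrid t₀ t n (k + 1))) ^ 2 *
        (f (uniformGrid t₀ t n (k + 1)) - f (uniformGrid t₀ t n k)))
      atTop (𝓝 (∫ u in Ioc t₀ t, Real.exp (-2 * a * ((t : ℝ) - u)) ∂(stieltjesOfPath f))) := by
  have hone : IntegrableOn (fun _ ↦ (1 : ℝ)) (id ⁻¹' Ioc t₀ t) (stieltjesOfPath f) := by
    rw [preimage_id, integrableOn_const_iff, stieltjesOfPath_Ioc hf hr]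
    exact Or.inr ENNReal.ofReal_lt_top
  have lim := tendsto_gridSum measurable_id h (φ := fun _ v ↦ Real.exp (-a * ((t : ℝ) - v)) ^ 2)
    (C := Real.exp (|a| * t) ^ 2)
    (fun _ _ v hv ↦ by rw [abs_pow]; gcongr; exact abs_exp_kernel_le a hv.2)
    (G := fun v ↦ Real.exp (-a * ((t : ℝ) - v)) ^ 2)
    (fun s hs ↦ ((tendsto_exp_kernel a t s).pow 2).comp tendsto_snd) hone
  have hG : ∀ u : ℝ≥0, Real.exp (-a * ((t : ℝ) - u)) ^ 2 * 1
      = Real.exp (-2 * a * ((t : ℝ) - u)) := by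
    intro u; rw [mul_one, ← Real.exp_nat_mul]; congr 1; push_cast; ring
  simp only [preimage_id, id, hG] at lim
  refine lim.congr fun n ↦ Finset.sum_congr rfl fun k _ ↦ ?_
  rw [setIntegral_const, smul_eq_mul, mul_one, measureReal_def, stieltjesOfPath_Ioc hf hr,
    ENNReal.toReal_ofReal (sub_nonneg.2 (hf (uniformGrid_mono t₀ t n (Nat.le_succ k))))]

/-! ### Brownian motion at an independent random time. -/

open Complex

/-- The sum of the increments of `x` along `r`, with weights `c`. -/
def weightedIncr (c : ℕ → ℝ) (r : ℕ → ℝ≥0) (n : ℕ) (x : ℝ≥0 → ℝ) : ℝ :=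
  ∑ k ∈ Finset.range n, c k * (x (r (k + 1)) - x (r k))

lemma integral_cexp_weightedIncr {Ω : Type*} {mΩ : MeasurableSpace Ω} {P : Measure Ω}
    {W : ℝ≥0 → Ω → ℝ} (hW : IsPreBrownianReal W P) (c : ℕ → ℝ) {l : ℕ → ℝ≥0} (hl : Monotone l)
    (n : ℕ) :
    ∫ ω, cexp ((weightedIncr c l n (fun s ↦ W s ω) : ℝ) * I) ∂P
      = ((Real.exp (-weightedIncr (fun k ↦ c k ^ 2) l n (fun s ↦ (s : ℝ)) / 2) : ℝ) : ℂ) := by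
  have : IsProbabilityMeasure P := hW.isGaussianProcess.isProbabilityMeasure
  set X : ℕ → Ω → ℝ := fun k ω ↦ c k * (W (l (k + 1)) ω - W (l k) ω) with hX
  have hm : ∀ k, AEMeasurable (X k) P := fun k ↦
    ((hW.aemeasurable _).sub (hW.aemeasurable _)).const_mul _
  have hind : iIndepFun X P :=
    (hW.hasIndepIncrements.nat hl).comp (fun k x ↦ c k * x) fun k ↦ measurable_const_mul _
  -- Frequency `1` suffices, since any other frequency can be absorbed into the weights `c`.
  have h1 := congrFun ((hind.restrict (Finset.range n)).charFun_map_fun_finsetSum_eq_prod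
    (fun k _ ↦ hm k)) 1
  rw [charFun_apply_real, integral_map
    (Finset.aemeasurable_fun_sum _ fun k _ ↦ hm k) (by fun_prop)] at h1
  have hlaw : ∀ k, charFun (P.map (X k)) 1
      = cexp (-((c k ^ 2 * ((l (k + 1) : ℝ) - l k) / 2 : ℝ) : ℂ)) := by
    intro k
    have e1 : P.map (X k) = (P.map (W (l (k + 1)) - W (l k))).map (c k * ·) := by
      rw [AEMeasurable.map_map_of_aemeasurable (by fun_prop)
        ((hW.aemeasurable _).sub (hW.aemeasurable _))]
      rfl
    rw [e1, (hW.hasLaw_sub _ _).map_eq, gaussianReal_map_const_mul, charFun_gaussianReal]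
    congr 1
    have hle : (l k : ℝ) ≤ l (k + 1) := by exact_mod_cast hl (Nat.le_succ k)
    have : ((nndist (l (k + 1)).1 (l k).1 : ℝ≥0) : ℝ) = (l (k + 1) : ℝ) - l k := by
      rw [coe_nndist, Real.dist_eq]
      exact abs_of_nonneg (sub_nonneg.2 hle)
    simp only [NNReal.coe_mul, this]
    push_cast
    simp
  convert h1 using 1
  · simp [weightedIncr, hX]
  · rw [Finset.prod_apply]
    simp_rw [hlaw]
    rw [← Complex.exp_sum, Complex.ofReal_exp]
    congr 1
    simp only [weightedIncr]
    push_cast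
    rw [Finset.sum_neg_distrib, neg_div, Finset.sum_div]

/-- The smallest multiple of `1 / (m + 1)` above `x`. -/
noncomputable def gridCeil (m : ℕ) (x : ℝ≥0) : ℝ≥0 := (⌈x * (m + 1)⌉₊ : ℝ≥0) / (m + 1)

lemma gridCeil_mono (m : ℕ) : Monotone (gridCeil m) := by
  intro x y h
  unfold gridCeil
  gcongr

lemma measurable_gridCeil (m : ℕ) : Measurable (gridCeil m) := by
  unfold gridCeil
  fun_prop

lemma tendsto_gridCeil (x : ℝ≥0) : Tendsto (fun m ↦ gridCeil m x) atTop (𝓝 x) := by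
  have hmesh : Tendsto (fun n : ℕ ↦ 1 / ((n : ℝ≥0) + 1)) atTop (𝓝 0) := by
    rw [← NNReal.tendsto_coe]
    simpa using tendsto_one_div_add_atTop_nhds_zero_nat (𝕜 := ℝ)
  have h1 : Tendsto (fun n : ℕ ↦ x + 1 / ((n : ℝ≥0) + 1)) atTop (𝓝 x) := by
    simpa using hmesh.const_add x
  refine tendsto_of_tendsto_of_tendsto_of_le_of_le tendsto_const_nhds h1 (fun m ↦ ?_) fun m ↦ ?_
  · change x ≤ gridCeil m x
    rw [gridCeil, le_div_iff₀ (by positivity)]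
    exact Nat.le_ceil _
  · change gridCeil m x ≤ x + 1 / ((m : ℝ≥0) + 1)
    rw [gridCeil, div_le_iff₀ (by positivity), add_mul, one_div, inv_mul_cancel₀ (by positivity)]
    exact (Nat.ceil_lt_add_one (by positivity)).le

/-- Evaluation `(w, x) ↦ w x` is not measurable for the product σ-field on all paths. Rounding
leaves only countably many times, which restores joint measurability. -/
lemma measurable_eval_gridCeil (m : ℕ) :
    Measurable fun p : (ℝ≥0 → ℝ) × ℝ≥0 ↦ p.1 (gridCeil m p.2) := by
  have h : Measurable fun p : (ℝ≥0 → ℝ) × ℕ ↦ p.1 ((p.2 : ℝ≥0) / (m + 1)) :=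
    measurable_from_prod_countable_left fun j ↦
      (measurable_pi_apply ((j : ℝ≥0) / (m + 1)) : Measurable fun x : ℝ≥0 → ℝ ↦ x _)
  exact h.comp (measurable_fst.prodMk
    (Nat.measurable_ceil.comp (measurable_snd.mul_const _)))

section Subordination

variable {Ω : Type*} {mΩ : MeasurableSpace Ω} {P : Measure Ω} {W : ℝ≥0 → Ω → ℝ}
  {Λ : ℝ≥0 → Ω → ℝ≥0}

lemma ae_tendsto_timeChanged_gridCeil (hW : IsBrownianReal W P) :
    ∀ᵐ ω ∂P, ∀ s, Tendsto (fun m ↦ W (gridCeil m (Λ s ω)) ω) atTop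
      (𝓝 (timeChanged W Λ s ω)) := by
  filter_upwards [hW.cont] with ω hω s
  exact (hω.tendsto _).comp (tendsto_gridCeil _)

lemma aemeasurable_timeChanged (hWm : ∀ t, Measurable (W t)) (hW : IsBrownianReal W P)
    (hΛ : ∀ t, Measurable (Λ t)) (s : ℝ≥0) : AEMeasurable (timeChanged W Λ s) P := by
  refine aemeasurable_of_tendsto_metrizable_ae' (f := fun m ω ↦ W (gridCeil m (Λ s ω)) ω)
    (fun m ↦ ?_) ((ae_tendsto_timeChanged_gridCeil hW).mono fun ω h ↦ h s)
  exact ((measurable_eval_gridCeil m).comp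
    ((measurable_pi_lambda (fun ω t ↦ W t ω) hWm).prodMk (hΛ s))).aemeasurable

lemma aemeasurable_weightedIncr {X : ℝ≥0 → Ω → ℝ} (hX : ∀ s, AEMeasurable (X s) P)
    (c : ℕ → ℝ) (r : ℕ → ℝ≥0) (n : ℕ) :
    AEMeasurable (fun ω ↦ weightedIncr c r n fun s ↦ X s ω) P :=
  Finset.aemeasurable_fun_sum _ fun _ _ ↦ ((hX _).sub (hX _)).const_mul _

lemma measurable_weightedIncr {X : ℝ≥0 → Ω → ℝ} (hX : ∀ s, Measurable (X s))
    (c : ℕ → ℝ) (r : ℕ → ℝ≥0) (n : ℕ) :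
    Measurable (fun ω ↦ weightedIncr c r n fun s ↦ X s ω) :=
  Finset.measurable_sum _ fun _ _ ↦ ((hX _).sub (hX _)).const_mul _

lemma weightedIncr_nonneg {c : ℕ → ℝ} (hc : ∀ k, 0 ≤ c k) {r : ℕ → ℝ≥0} {x : ℝ≥0 → ℝ}
    (hx : Monotone (x ∘ r)) (n : ℕ) : 0 ≤ weightedIncr c r n x :=
  Finset.sum_nonneg fun k _ ↦ mul_nonneg (hc k) (sub_nonneg.2 (hx (Nat.le_succ k)))

lemma tendsto_weightedIncr {c : ℕ → ℝ} {r : ℕ → ℝ≥0} {n : ℕ} {x : ℕ → ℝ≥0 → ℝ} {x' : ℝ≥0 → ℝ}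
    (h : ∀ s, Tendsto (fun m ↦ x m s) atTop (𝓝 (x' s))) :
    Tendsto (fun m ↦ weightedIncr c r n (x m)) atTop (𝓝 (weightedIncr c r n x')) :=
  tendsto_finsetSum _ fun _ _ ↦ ((h _).sub (h _)).const_mul _

/-- By independence the law of `(W, Λ)` is a product, so Fubini allows integrating over `W` with the
time path frozen. The test function `f` of `Λ` encodes the conditioning. -/
lemma integral_cexp_weightedIncr_gridCeil [IsProbabilityMeasure P]
    (hWm : ∀ t, Measurable (W t)) (hW : IsPreBrownianReal W P)
    (hΛm : ∀ t, Measurable (Λ t)) (hΛ : ∀ᵐ ω ∂P, Monotone fun t ↦ Λ t ω)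
    (hind : IndepFun (fun ω t ↦ W t ω) (fun ω t ↦ Λ t ω) P)
    (c : ℕ → ℝ) {r : ℕ → ℝ≥0} (hr : Monotone r) (n m : ℕ)
    {f : (ℝ≥0 → ℝ≥0) → ℂ} (hf : Measurable f) (hf1 : ∀ x, ‖f x‖ ≤ 1) :
    ∫ ω, cexp ((weightedIncr c r n (fun s ↦ W (gridCeil m (Λ s ω)) ω) : ℝ) * I)
        * f (fun s ↦ Λ s ω) ∂P
      = ∫ ω, ((Real.exp (-weightedIncr (fun k ↦ c k ^ 2) r n
          (fun s ↦ (gridCeil m (Λ s ω) : ℝ)) / 2) : ℝ) : ℂ) * f (fun s ↦ Λ s ω) ∂P := by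
  have hWp : Measurable fun ω t ↦ W t ω := measurable_pi_lambda _ hWm
  have hΛp : Measurable fun ω t ↦ Λ t ω := measurable_pi_lambda _ hΛm
  set ν := P.map fun ω t ↦ W t ω with hν
  set μ := P.map fun ω t ↦ Λ t ω with hμ
  have : IsProbabilityMeasure ν := Measure.isProbabilityMeasure_map hWp.aemeasurable
  have : IsProbabilityMeasure μ := Measure.isProbabilityMeasure_map hΛp.aemeasurable
  have hprod := hind.map_prod_eq_prod_map_map hWp.aemeasurable hΛp.aemeasurable
  set F : (ℝ≥0 → ℝ) × (ℝ≥0 → ℝ≥0) → ℂ := fun p ↦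
    cexp ((weightedIncr c r n (fun s ↦ p.1 (gridCeil m (p.2 s))) : ℝ) * I) * f p.2 with hF
  have hSm : Measurable fun p : (ℝ≥0 → ℝ) × (ℝ≥0 → ℝ≥0) ↦
      weightedIncr c r n (fun s ↦ p.1 (gridCeil m (p.2 s))) :=
    measurable_weightedIncr (fun s ↦ (measurable_eval_gridCeil m).comp
      (measurable_fst.prodMk ((measurable_pi_apply s).comp measurable_snd))) c r n
  have hFm : Measurable F := by
    have : Measurable fun p : (ℝ≥0 → ℝ) × (ℝ≥0 → ℝ≥0) ↦ f p.2 := hf.comp measurable_snd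
    exact (by fun_prop : Measurable fun x : ℝ ↦ cexp ((x : ℂ) * I)).comp hSm |>.mul this
  have hFi : Integrable F (ν.prod μ) := by
    refine Integrable.of_bound hFm.aestronglyMeasurable 1 (ae_of_all _ fun p ↦ ?_)
    rw [hF, norm_mul, Complex.norm_exp_ofReal_mul_I, one_mul]
    exact hf1 _
  -- Monotonicity on all of `ℝ≥0` is an uncountable condition; it is transferred to the law of `Λ`
  -- only along the countably many times `r k`.
  have hmono : ∀ᵐ x ∂μ, Monotone fun k ↦ x (r k) := by
    have : ∀ᵐ x ∂μ, ∀ k, x (r k) ≤ x (r (k + 1)) := by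
      refine ae_all_iff.2 fun k ↦ ?_
      rw [hμ, ae_map_iff hΛp.aemeasurable
        (measurableSet_le (measurable_pi_apply _) (measurable_pi_apply _))]
      exact hΛ.mono fun ω h ↦ h (hr (Nat.le_succ k))
    exact this.mono fun x hx ↦ monotone_nat_of_le_succ hx
  have hVm : Measurable fun x : ℝ≥0 → ℝ≥0 ↦ ((Real.exp (-weightedIncr (fun k ↦ c k ^ 2) r n
      (fun s ↦ (gridCeil m (x s) : ℝ)) / 2) : ℝ) : ℂ) * f x := by
    have := measurable_weightedIncr (Ω := ℝ≥0 → ℝ≥0)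
      (X := fun s x ↦ (gridCeil m (x s) : ℝ)) (fun s ↦ measurable_coe_nnreal_real.comp
        ((measurable_gridCeil m).comp (measurable_pi_apply s))) (fun k ↦ c k ^ 2) r n
    exact ((by fun_prop : Measurable fun v : ℝ ↦ ((Real.exp (-v / 2) : ℝ) : ℂ)).comp this).mul hf
  calc _ = ∫ p, F p ∂(P.map fun ω ↦ ((fun t ↦ W t ω), fun t ↦ Λ t ω)) := by
        rw [integral_map (hWp.prodMk hΛp).aemeasurable hFm.aestronglyMeasurable]
    _ = ∫ x, ∫ w, F (w, x) ∂ν ∂μ := by rw [hprod, integral_prod_symm _ hFi]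
    _ = ∫ x, ((Real.exp (-weightedIncr (fun k ↦ c k ^ 2) r n
          (fun s ↦ (gridCeil m (x s) : ℝ)) / 2) : ℝ) : ℂ) * f x ∂μ := by
        refine integral_congr_ae (hmono.mono fun x hx ↦ ?_)
        simp only [hF]
        rw [integral_mul_const]
        congr 1
        rw [hν, integral_map hWp.aemeasurable]
        · exact integral_cexp_weightedIncr hW c
            (l := fun k ↦ gridCeil m (x (r k))) ((gridCeil_mono m).comp hx) n
        · exact ((by fun_prop : Measurable fun x : ℝ ↦ cexp ((x : ℂ) * I)).comp
            (hSm.comp measurable_prodMk_right)).aestronglyMeasurable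
    _ = _ := by rw [hμ, integral_map hΛp.aemeasurable hVm.aestronglyMeasurable]

/-- Conditionally on an independent time change `Λ`, the weighted increments of `W_Λ` are
centred Gaussian, with the weighted increments of `Λ` as variance. -/
lemma integral_cexp_weightedIncr_timeChanged [IsProbabilityMeasure P]
    (hWm : ∀ t, Measurable (W t)) (hW : IsBrownianReal W P)
    (hΛm : ∀ t, Measurable (Λ t)) (hΛ : ∀ᵐ ω ∂P, Monotone fun t ↦ Λ t ω)
    (hind : IndepFun (fun ω t ↦ W t ω) (fun ω t ↦ Λ t ω) P)
    (c : ℕ → ℝ) {r : ℕ → ℝ≥0} (hr : Monotone r) (n : ℕ)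
    {f : (ℝ≥0 → ℝ≥0) → ℂ} (hf : Measurable f) (hf1 : ∀ x, ‖f x‖ ≤ 1) :
    ∫ ω, cexp ((weightedIncr c r n (fun s ↦ timeChanged W Λ s ω) : ℝ) * I)
        * f (fun s ↦ Λ s ω) ∂P
      = ∫ ω, ((Real.exp (-weightedIncr (fun k ↦ c k ^ 2) r n
          (fun s ↦ (Λ s ω : ℝ)) / 2) : ℝ) : ℂ) * f (fun s ↦ Λ s ω) ∂P := by
  have hWp : Measurable fun ω t ↦ W t ω := measurable_pi_lambda _ hWm
  have hΛp : Measurable fun ω t ↦ Λ t ω := measurable_pi_lambda _ hΛm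
  have hfΛ : Measurable fun ω ↦ f (fun s ↦ Λ s ω) := hf.comp hΛp
  have lim1 : Tendsto (fun m ↦ ∫ ω, cexp ((weightedIncr c r n
      (fun s ↦ W (gridCeil m (Λ s ω)) ω) : ℝ) * I) * f (fun s ↦ Λ s ω) ∂P) atTop
      (𝓝 (∫ ω, cexp ((weightedIncr c r n (fun s ↦ timeChanged W Λ s ω) : ℝ) * I)
        * f (fun s ↦ Λ s ω) ∂P)) := by
    refine tendsto_integral_of_dominated_convergence (fun _ ↦ 1) (fun m ↦ ?_)
      (integrable_const _) (fun m ↦ ae_of_all _ fun ω ↦ ?_) ?_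
    · have := measurable_weightedIncr (X := fun s ω ↦ W (gridCeil m (Λ s ω)) ω) (fun s ↦
        (measurable_eval_gridCeil m).comp (hWp.prodMk (hΛm s))) c r n
      exact (((by fun_prop : Measurable fun x : ℝ ↦ cexp ((x : ℂ) * I)).comp this).mul
        hfΛ).aestronglyMeasurable
    · rw [norm_mul, Complex.norm_exp_ofReal_mul_I, one_mul]
      exact hf1 _
    -- Continuity of the Brownian paths removes the rounding of the time change.
    · filter_upwards [ae_tendsto_timeChanged_gridCeil (Λ := Λ) hW] with ω hω
      exact (((by fun_prop : Continuous fun x : ℝ ↦ cexp ((x : ℂ) * I)).tendsto _).comp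
        (tendsto_weightedIncr hω)).mul_const _
  have lim2 : Tendsto (fun m ↦ ∫ ω, ((Real.exp (-weightedIncr (fun k ↦ c k ^ 2) r n
        (fun s ↦ (gridCeil m (Λ s ω) : ℝ)) / 2) : ℝ) : ℂ) * f (fun s ↦ Λ s ω) ∂P) atTop
      (𝓝 (∫ ω, ((Real.exp (-weightedIncr (fun k ↦ c k ^ 2) r n
          (fun s ↦ (Λ s ω : ℝ)) / 2) : ℝ) : ℂ) * f (fun s ↦ Λ s ω) ∂P)) := by
    refine tendsto_integral_of_dominated_convergence (fun _ ↦ 1) (fun m ↦ ?_)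
      (integrable_const _) (fun m ↦ ?_) (ae_of_all _ fun ω ↦ ?_)
    · have := measurable_weightedIncr (X := fun s ω ↦ (gridCeil m (Λ s ω) : ℝ)) (fun s ↦
        measurable_coe_nnreal_real.comp ((measurable_gridCeil m).comp (hΛm s)))
        (fun k ↦ c k ^ 2) r n
      exact (((by fun_prop : Measurable fun v : ℝ ↦ ((Real.exp (-v / 2) : ℝ) : ℂ)).comp this).mul
        hfΛ).aestronglyMeasurable
    · filter_upwards [hΛ] with ω hω
      have : 0 ≤ weightedIncr (fun k ↦ c k ^ 2) r n (fun s ↦ (gridCeil m (Λ s ω) : ℝ)) :=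
        weightedIncr_nonneg (fun k ↦ sq_nonneg _)
          (NNReal.coe_mono.comp ((gridCeil_mono m).comp (hω.comp hr))) n
      rw [norm_mul, Complex.norm_real, Real.norm_eq_abs, Real.abs_exp]
      exact mul_le_one₀ (Real.exp_le_one_iff.2 (by linarith)) (norm_nonneg _) (hf1 _)
    · have : ∀ s, Tendsto (fun m ↦ (gridCeil m (Λ s ω) : ℝ)) atTop (𝓝 (Λ s ω : ℝ)) :=
        fun s ↦ (NNReal.tendsto_coe.2 (tendsto_gridCeil _))
      exact (((by fun_prop : Continuous fun v : ℝ ↦ ((Real.exp (-v / 2) : ℝ) : ℂ)).tendsto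
        _).comp (tendsto_weightedIncr this)).mul_const _
  refine tendsto_nhds_unique lim1 (lim2.congr fun m ↦ ?_)
  exact (integral_cexp_weightedIncr_gridCeil hWm hW.toIsPreBrownianReal hΛm hΛ hind c hr n m
    hf hf1).symm

end Subordination

/-! ### Conditional laws from characteristic functions. -/

lemma generateFrom_inter_eq_sup {Ω : Type*} (m₁ m₂ : MeasurableSpace Ω) :
    m₁ ⊔ m₂ = MeasurableSpace.generateFrom
      {s | ∃ A B, MeasurableSet[m₁] A ∧ MeasurableSet[m₂] B ∧ s = A ∩ B} := by
  apply le_antisymm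
  · refine sup_le (fun A hA ↦ ?_) fun B hB ↦ ?_
    · exact MeasurableSpace.measurableSet_generateFrom
        ⟨A, univ, hA, MeasurableSet.univ, (inter_univ A).symm⟩
    · exact MeasurableSpace.measurableSet_generateFrom
        ⟨univ, B, MeasurableSet.univ, hB, (univ_inter B).symm⟩
  · refine MeasurableSpace.generateFrom_le ?_
    rintro _ ⟨A, B, hA, hB, rfl⟩
    exact MeasurableSet.inter (m := m₁ ⊔ m₂) ((le_sup_left : m₁ ≤ m₁ ⊔ m₂) _ hA)
      ((le_sup_right : m₂ ≤ m₁ ⊔ m₂) _ hB)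

lemma isPiSystem_inter {Ω : Type*} (m₁ m₂ : MeasurableSpace Ω) :
    IsPiSystem {s | ∃ A B, MeasurableSet[m₁] A ∧ MeasurableSet[m₂] B ∧ s = A ∩ B} := by
  rintro _ ⟨A, B, hA, hB, rfl⟩ _ ⟨A', B', hA', hB', rfl⟩ _
  exact ⟨A ∩ A', B ∩ B', hA.inter hA', hB.inter hB', by ext; simp; tauto⟩

lemma charFun_bind {Ω : Type*} {mΩ : MeasurableSpace Ω} (μ : Measure Ω) [IsFiniteMeasure μ]
    {κ : Ω → Measure ℝ} (hκ : Measurable κ) [∀ ω, IsProbabilityMeasure (κ ω)] (θ : ℝ) :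
    charFun (μ.bind κ) θ = ∫ ω, charFun (κ ω) θ ∂μ := by
  let η : Kernel Ω ℝ := ⟨κ, hκ⟩
  have : IsMarkovKernel η := ⟨fun ω ↦ inferInstanceAs (IsProbabilityMeasure (κ ω))⟩
  change charFun (μ.bind η) θ = _
  rw [← Measure.snd_compProd, charFun_apply_real, Measure.snd, integral_map (by fun_prop)
    (by fun_prop), Measure.integral_compProd]
  · simp only [charFun_apply_real]
    rfl
  · refine Integrable.of_bound (by fun_prop) 1 (ae_of_all _ fun p ↦ ?_)
    rw [← ofReal_mul, Complex.norm_exp_ofReal_mul_I]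

/-- A random probability measure is the conditional law of `X` given `m₁ ⊔ m₂` as soon as the
conditional characteristic functions agree on intersections of sets from `m₁` and `m₂`. -/
lemma condProb_ae_eq_of_charFun {Ω : Type*} {m₁ m₂ mΩ : MeasurableSpace Ω} {P : Measure Ω}
    [IsProbabilityMeasure P] {X : Ω → ℝ} (hX : AEMeasurable X P)
    (hm : m₁ ⊔ m₂ ≤ mΩ) {κ : Ω → Measure ℝ} (hκ : Measurable[m₁ ⊔ m₂] κ)
    [∀ ω, IsProbabilityMeasure (κ ω)]
    (h : ∀ A B, MeasurableSet[m₁] A → MeasurableSet[m₂] B → ∀ θ : ℝ,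
      ∫ ω in A ∩ B, cexp (θ * X ω * I) ∂P = ∫ ω in A ∩ B, charFun (κ ω) θ ∂P)
    {D : Set ℝ} (hD : MeasurableSet D) :
    P⟦X ⁻¹' D | m₁ ⊔ m₂⟧ =ᵐ[P] fun ω ↦ (κ ω).real D := by
  have hκ' : Measurable κ := hκ.mono hm le_rfl
  have hκD : Measurable[m₁ ⊔ m₂] fun ω ↦ κ ω D := (Measure.measurable_coe hD).comp hκ
  have hnull : NullMeasurableSet (X ⁻¹' D) P := hX.nullMeasurableSet_preimage hD
  have hlaw : ∀ A B, MeasurableSet[m₁] A → MeasurableSet[m₂] B →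
      P (X ⁻¹' D ∩ (A ∩ B)) = ∫⁻ ω in A ∩ B, κ ω D ∂P := by
    intro A B hA hB
    have hAB : MeasurableSet (A ∩ B) :=
      (hm _ ((le_sup_left : m₁ ≤ m₁ ⊔ m₂) _ hA)).inter
        (hm _ ((le_sup_right : m₂ ≤ m₁ ⊔ m₂) _ hB))
    have : IsFiniteMeasure ((P.restrict (A ∩ B)).bind κ) := by
      constructor
      rw [Measure.bind_apply MeasurableSet.univ hκ'.aemeasurable]
      simp
    -- On the fixed event, the law of `X` and the mixture of the `κ ω` are finite measures with the
    -- same characteristic function.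
    have heq : (P.restrict (A ∩ B)).map X = (P.restrict (A ∩ B)).bind κ := by
      refine Measure.ext_of_charFun (funext fun θ ↦ ?_)
      rw [charFun_bind _ hκ', ← h A B hA hB, charFun_apply_real,
        integral_map hX.restrict (by fun_prop)]
    have := DFunLike.congr_fun heq D
    rwa [Measure.map_apply_of_aemeasurable hX.restrict hD,
      Measure.bind_apply hD hκ'.aemeasurable, Measure.restrict_apply₀' hAB.nullMeasurableSet]
      at this
  -- Both sides are finite measures in `C` that agree on a π-system generating `m₁ ⊔ m₂`.
  have hall : ∀ C, MeasurableSet[m₁ ⊔ m₂] C → P (X ⁻¹' D ∩ C) = ∫⁻ ω in C, κ ω D ∂P := by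
    have e1 : ∀ C, MeasurableSet C → P.restrict (X ⁻¹' D) C = P (X ⁻¹' D ∩ C) := fun C hC ↦ by
      rw [Measure.restrict_apply hC, inter_comm]
    have e2 : ∀ C, MeasurableSet C → P.withDensity (fun ω ↦ κ ω D) C = ∫⁻ ω in C, κ ω D ∂P :=
      fun C hC ↦ withDensity_apply _ hC
    have hmeas : ∀ A B, MeasurableSet[m₁] A → MeasurableSet[m₂] B → MeasurableSet (A ∩ B) :=
      fun A B hA hB ↦ (hm _ ((le_sup_left : m₁ ≤ m₁ ⊔ m₂) _ hA)).inter
        (hm _ ((le_sup_right : m₂ ≤ m₁ ⊔ m₂) _ hB))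
    intro C hC
    rw [← e1 C (hm _ hC), ← e2 C (hm _ hC)]
    refine ext_on_measurableSpace_of_generate_finite mΩ _ ?_ hm
      (generateFrom_inter_eq_sup m₁ m₂) (isPiSystem_inter m₁ m₂) ?_ hC
    · rintro _ ⟨A, B, hA, hB, rfl⟩
      rw [e1 _ (hmeas A B hA hB), e2 _ (hmeas A B hA hB), hlaw A B hA hB]
    · rw [e1 _ .univ, e2 _ .univ]
      simpa using hlaw univ univ MeasurableSet.univ MeasurableSet.univ
  symm
  have hint : Integrable (fun ω ↦ (κ ω).real D) P := by
    refine Integrable.of_bound ((hκD.mono hm le_rfl).ennreal_toReal).aestronglyMeasurable 1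
      (ae_of_all _ fun ω ↦ ?_)
    rw [Real.norm_eq_abs, abs_of_nonneg measureReal_nonneg]
    exact measureReal_le_one
  refine ae_eq_condExp_of_forall_setIntegral_eq hm ?_ (fun s _ _ ↦ hint.integrableOn)
    (fun C hC _ ↦ ?_) ?_
  · exact (integrable_const _).indicator₀ hnull
  · have hC' := hm _ hC
    rw [integral_indicator₀ (hnull.mono_ac Measure.restrict_le_self.absolutelyContinuous),
      setIntegral_const, smul_eq_mul, mul_one,
      measureReal_def, Measure.restrict_apply₀' hC'.nullMeasurableSet]
    simp only [measureReal_def]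
    rw [integral_toReal (hκD.mono hm le_rfl).aemeasurable (ae_of_all _ fun ω ↦ measure_lt_top _ _)]
    simp [← hall C hC]
  · exact (hκD.ennreal_toReal).stronglyMeasurable.aestronglyMeasurable

/-! ### Splitting the conditioning σ-field at `t₀`. -/

/-- The σ-field generated by the increments of `Λ` over `[t₀, t]` from `t₀`. -/
@[reducible]
def incrementSigma {Ω : Type*} (Λ : ℝ≥0 → Ω → ℝ≥0) (t₀ t : ℝ≥0) : MeasurableSpace Ω :=
  ⨆ h : ℝ≥0, ⨆ _ : h ≤ t - t₀, MeasurableSpace.comap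
    (fun ω ↦ (Λ (t₀ + h) ω : ℝ) - Λ t₀ ω) inferInstance

section Sigma

variable {Ω : Type*} {W : ℝ≥0 → Ω → ℝ} {Λ : ℝ≥0 → Ω → ℝ≥0} {t₀ t : ℝ≥0}

lemma measurable_pastSigma {u : ℝ≥0} (hu : u ≤ t) : Measurable[pastSigma Λ t] (Λ u) :=
  Measurable.mono (comap_measurable (Λ u)) (le_iSup₂_of_le u hu le_rfl) le_rfl

lemma pastSigma_le {m : MeasurableSpace Ω} (h : ∀ u ≤ t, Measurable[m] (Λ u)) :
    pastSigma Λ t ≤ m :=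
  iSup₂_le fun u hu ↦ (h u hu).comap_le

lemma incrementSigma_le {m : MeasurableSpace Ω}
    (h : ∀ u ∈ Icc t₀ t, Measurable[m] fun ω ↦ (Λ u ω : ℝ) - Λ t₀ ω) :
    incrementSigma Λ t₀ t ≤ m := by
  refine iSup₂_le fun u hu ↦ ?_
  by_cases ht : t₀ ≤ t
  · refine (h (t₀ + u) ⟨le_self_add, ?_⟩).comap_le
    calc t₀ + u ≤ t₀ + (t - t₀) := by gcongr
      _ = t := add_tsub_cancel_of_le ht
  -- For `t < t₀` the truncated difference `t - t₀` is `0`, so only the zero increment contributes.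
  · have h0 : u = 0 := by
      rw [tsub_eq_zero_of_le (not_le.1 ht).le] at hu
      exact le_antisymm hu zero_le
    subst h0
    simp

lemma measurable_incrementSigma {u : ℝ≥0} (hu : u ∈ Icc t₀ t) :
    Measurable[incrementSigma Λ t₀ t] fun ω ↦ (Λ u ω : ℝ) - Λ t₀ ω := by
  have h := comap_measurable (m := Real.measurableSpace) (fun ω ↦ (Λ (t₀ + (u - t₀)) ω : ℝ) - Λ t₀ ω)
  have := h.mono (le_iSup₂_of_le (f := fun (h : ℝ≥0) (_ : h ≤ t - t₀) ↦ MeasurableSpace.comap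
    (fun ω ↦ (Λ (t₀ + h) ω : ℝ) - Λ t₀ ω) inferInstance) (u - t₀)
    (tsub_le_tsub_right hu.2 _) le_rfl) le_rfl
  rwa [add_tsub_cancel_of_le hu.1] at this

/-- For `u ≥ t₀`, `Λ u` is recovered from `Λ t₀` and the increment. This form isolates a factor
contained in the future increments, to which nonanticipation applies. -/
lemma sup_pastSigma_eq (ht : t₀ ≤ t) (m : MeasurableSpace Ω) :
    m ⊔ pastSigma Λ t = (m ⊔ pastSigma Λ t₀) ⊔ incrementSigma Λ t₀ t := by
  apply le_antisymm
  · refine sup_le (le_sup_left.trans le_sup_left) (pastSigma_le fun u hu ↦ ?_)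
    have hpast : pastSigma Λ t₀ ≤ (m ⊔ pastSigma Λ t₀) ⊔ incrementSigma Λ t₀ t :=
      le_sup_right.trans le_sup_left
    rcases le_total u t₀ with h | h
    · exact (measurable_pastSigma h).mono hpast le_rfl
    · have h1 := (measurable_incrementSigma (Λ := Λ) (⟨h, hu⟩ : u ∈ Icc t₀ t)).mono
        (le_sup_right : _ ≤ (m ⊔ pastSigma Λ t₀) ⊔ incrementSigma Λ t₀ t) le_rfl
      have h2 := (measurable_pastSigma (Λ := Λ) (le_refl t₀)).mono hpast le_rfl
      have h3 := (h1.add (measurable_coe_nnreal_real.comp h2)).real_toNNReal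
      convert h3 using 2 with ω
      simp
  · refine sup_le (sup_le le_sup_left ?_) ?_
    · exact (pastSigma_le fun u hu ↦ measurable_pastSigma (hu.trans ht)).trans le_sup_right
    · refine (incrementSigma_le fun u hu ↦ ?_).trans le_sup_right
      exact (measurable_coe_nnreal_real.comp (measurable_pastSigma hu.2)).sub
        (measurable_coe_nnreal_real.comp (measurable_pastSigma ht))

lemma measurable_futureIncrementSigma {u : ℝ≥0} (hu : t₀ ≤ u) :
    Measurable[futureIncrementSigma W Λ t₀] fun ω ↦
      ((Λ u ω : ℝ) - Λ t₀ ω, timeChanged W Λ u ω - timeChanged W Λ t₀ ω) := by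
  have h := comap_measurable (m := Prod.instMeasurableSpace) (fun ω ↦
    ((Λ (t₀ + (u - t₀)) ω : ℝ) - Λ t₀ ω,
      timeChanged W Λ (t₀ + (u - t₀)) ω - timeChanged W Λ t₀ ω))
  have := h.mono (le_iSup (fun h : ℝ≥0 ↦ MeasurableSpace.comap
    (fun ω ↦ ((Λ (t₀ + h) ω : ℝ) - Λ t₀ ω,
      timeChanged W Λ (t₀ + h) ω - timeChanged W Λ t₀ ω)) inferInstance) (u - t₀)) le_rfl
  rwa [add_tsub_cancel_of_le hu] at this

lemma incrementSigma_le_futureIncrementSigma :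
    incrementSigma Λ t₀ t ≤ futureIncrementSigma W Λ t₀ :=
  incrementSigma_le fun _ hu ↦ measurable_fst.comp (measurable_futureIncrementSigma hu.1)

lemma incrementSigma_le_comap :
    incrementSigma Λ t₀ t ≤ MeasurableSpace.comap (fun ω s ↦ Λ s ω) MeasurableSpace.pi := by
  have h : ∀ s, Measurable[MeasurableSpace.comap (fun ω s ↦ Λ s ω) MeasurableSpace.pi]
      fun ω ↦ (Λ s ω : ℝ) := fun s ↦
    (measurable_coe_nnreal_real.comp (measurable_pi_apply s) :
      Measurable fun x : ℝ≥0 → ℝ≥0 ↦ (x s : ℝ)).comp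
      (comap_measurable (m := MeasurableSpace.pi) (fun ω s ↦ Λ s ω))
  exact incrementSigma_le fun u _ ↦ (h u).sub (h t₀)

lemma measurable_weightedIncr_of_sub {m : MeasurableSpace Ω} {X : ℝ≥0 → Ω → ℝ}
    (hX : ∀ u, t₀ ≤ u → Measurable[m] fun ω ↦ X u ω - X t₀ ω)
    (c : ℕ → ℝ) {r : ℕ → ℝ≥0} (hr : ∀ k, t₀ ≤ r k) (n : ℕ) :
    Measurable[m] fun ω ↦ weightedIncr c r n fun s ↦ X s ω := by
  have : ∀ ω, weightedIncr c r n (fun s ↦ X s ω)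
      = ∑ k ∈ Finset.range n, c k * ((X (r (k + 1)) ω - X t₀ ω) - (X (r k) ω - X t₀ ω)) :=
    fun ω ↦ Finset.sum_congr rfl fun k _ ↦ by ring
  simp_rw [this]
  exact Finset.measurable_sum _ fun k _ ↦ ((hX _ (hr _)).sub (hX _ (hr _))).const_mul _

end Sigma

lemma le_uniformGrid (t₀ t : ℝ≥0) (n k : ℕ) : t₀ ≤ uniformGrid t₀ t n k := le_self_add

/-! ### Conditional characteristic function of the solution. -/

section CharFun

variable {Ω : Type*} {mΩ : MeasurableSpace Ω} {P : Measure Ω}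
  {ℱ : Filtration ℝ≥0 mΩ} {W : ℝ≥0 → Ω → ℝ} {Λ : ℝ≥0 → Ω → ℝ≥0} {t₀ t : ℝ≥0}

/-- Independence factors out `1_A e^{iξ}` from the part depending on later increments. The other
factor is the Fourier identity for `W_Λ` tested against `1_B`. The Gaussian factor also depends only
on later increments, so the product can be reassembled. -/
lemma setIntegral_cexp_weightedIncr [IsProbabilityMeasure P]
    (hWm : ∀ t, Measurable (W t)) (hW : IsBrownianReal W P)
    (hΛm : ∀ t, Measurable (Λ t)) (hΛ : ∀ᵐ ω ∂P, Monotone fun t ↦ Λ t ω)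
    (hind : IndepFun (fun ω t ↦ W t ω) (fun ω t ↦ Λ t ω) P)
    (hℱ : IsNonanticipating ℱ W Λ P) {ξ : Ω → ℝ} (hξ : Measurable[ℱ t₀ ⊔ pastSigma Λ t₀] ξ)
    {A B : Set Ω} (hA : MeasurableSet[ℱ t₀ ⊔ pastSigma Λ t₀] A)
    (hB : MeasurableSet[incrementSigma Λ t₀ t] B)
    (c : ℕ → ℝ) {r : ℕ → ℝ≥0} (hr : Monotone r) (hr₀ : ∀ k, t₀ ≤ r k) (n : ℕ) :
    ∫ ω in A ∩ B, cexp (ξ ω * I)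
        * cexp ((weightedIncr c r n (fun s ↦ timeChanged W Λ s ω) : ℝ) * I) ∂P
      = ∫ ω in A ∩ B, cexp (ξ ω * I) * ((Real.exp (-weightedIncr (fun k ↦ c k ^ 2) r n
          (fun s ↦ (Λ s ω : ℝ)) / 2) : ℝ) : ℂ) ∂P := by
  have hm₁ : ℱ t₀ ⊔ pastSigma Λ t₀ ≤ mΩ := sup_le (ℱ.le t₀) (pastSigma_le fun u _ ↦ hΛm u)
  have hm₂ : incrementSigma Λ t₀ t ≤ mΩ := incrementSigma_le fun u _ ↦
    (measurable_coe_nnreal_real.comp (hΛm u)).sub (measurable_coe_nnreal_real.comp (hΛm t₀))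
  -- `B` plays two roles: an event of the path of `Λ`, giving the test function `f`, and an event of
  -- the future increments, giving independence from `A` and `ξ`.
  obtain ⟨B', hB', hBB'⟩ := incrementSigma_le_comap B hB
  have hBf := incrementSigma_le_futureIncrementSigma (W := W) B hB
  set U : Ω → ℂ := A.indicator fun ω ↦ cexp (ξ ω * I) with hU
  have hUm : Measurable[ℱ t₀ ⊔ pastSigma Λ t₀] U :=
    ((by fun_prop : Measurable fun x : ℝ ↦ cexp ((x : ℂ) * I)).comp hξ).indicator hA
  set f : (ℝ≥0 → ℝ≥0) → ℂ := B'.indicator fun _ ↦ 1 with hf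
  have hfm : Measurable f := measurable_const.indicator hB'
  have hf1 : ∀ x, ‖f x‖ ≤ 1 := fun x ↦ by
    simp only [hf, indicator]; split_ifs <;> simp
  have hfB : ∀ ω, f (fun s ↦ Λ s ω) = B.indicator (fun _ ↦ (1 : ℂ)) ω := fun ω ↦ by
    rw [← hBB']; rfl
  have key : ∀ Z : Ω → ℂ, Measurable[futureIncrementSigma W Λ t₀] Z → AEStronglyMeasurable Z P →
      ∫ ω in A ∩ B, cexp (ξ ω * I) * Z ω ∂P
        = (∫ ω, Z ω * f (fun s ↦ Λ s ω) ∂P) * ∫ ω, U ω ∂P := by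
    intro Z hZ hZ'
    have hZf : Measurable[futureIncrementSigma W Λ t₀] fun ω ↦ Z ω * f (fun s ↦ Λ s ω) := by
      simp_rw [hfB]
      exact hZ.mul (measurable_const.indicator hBf)
    have hi : IndepFun (fun ω ↦ Z ω * f (fun s ↦ Λ s ω)) U P := by
      rw [IndepFun_iff_Indep]
      exact indep_of_indep_of_le_left (indep_of_indep_of_le_right (hℱ t₀) hUm.comap_le)
        hZf.comap_le
    have hfΛ : Measurable fun ω ↦ f (fun s ↦ Λ s ω) :=
      hfm.comp (measurable_pi_lambda _ hΛm)
    have := hi.integral_fun_mul_eq_mul_integral (hZ'.mul hfΛ.aestronglyMeasurable)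
      (hUm.mono hm₁ le_rfl).aestronglyMeasurable
    rw [← this, ← integral_indicator ((hm₁ _ hA).inter (hm₂ _ hB))]
    refine integral_congr_ae (ae_of_all _ fun ω ↦ ?_)
    simp only [hfB, hU]
    by_cases h1 : ω ∈ A <;> by_cases h2 : ω ∈ B <;> simp [h1, h2, mul_comm]
  have hS := measurable_weightedIncr_of_sub (m := futureIncrementSigma W Λ t₀)
    (X := timeChanged W Λ) (fun u hu ↦ measurable_snd.comp (measurable_futureIncrementSigma hu))
    c hr₀ n
  have hV := measurable_weightedIncr_of_sub (m := futureIncrementSigma W Λ t₀)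
    (X := fun s ω ↦ (Λ s ω : ℝ))
    (fun u hu ↦ measurable_fst.comp (measurable_futureIncrementSigma hu)) (fun k ↦ c k ^ 2) hr₀ n
  have hS' := aemeasurable_weightedIncr (fun s ↦ aemeasurable_timeChanged hWm hW hΛm s) c r n
  have hV' := measurable_weightedIncr
    (fun s ↦ measurable_coe_nnreal_real.comp (hΛm s)) (fun k ↦ c k ^ 2) r n
  have me1 : Measurable fun x : ℝ ↦ cexp ((x : ℂ) * I) := by fun_prop
  have me2 : Measurable fun v : ℝ ↦ ((Real.exp (-v / 2) : ℝ) : ℂ) := by fun_prop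
  refine (key _ (me1.comp hS) (me1.comp_aemeasurable hS').aestronglyMeasurable).trans
    (Eq.trans ?_ (key _ (me2.comp hV) (me2.comp hV').aestronglyMeasurable).symm)
  congr 1
  exact integral_cexp_weightedIncr_timeChanged hWm hW hΛm hΛ hind c hr n hfm hf1

/-- The weighted increments of `Λ` approximating `ouVariance` along the uniform partitions. -/
noncomputable def ouVarianceSum (a : ℝ) (Λ : ℝ≥0 → Ω → ℝ≥0) (t₀ t : ℝ≥0) (n : ℕ) (ω : Ω) : ℝ :=
  weightedIncr (fun k ↦ Real.exp (-a * ((t : ℝ) - uniformGrid t₀ t n (k + 1))) ^ 2)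
    (uniformGrid t₀ t n) (n + 1) (fun s ↦ (Λ s ω : ℝ))

lemma ouVarianceSum_nonneg (a : ℝ) {ω : Ω} (h : Monotone fun s ↦ Λ s ω) (n : ℕ) :
    0 ≤ ouVarianceSum a Λ t₀ t n ω :=
  weightedIncr_nonneg (fun _ ↦ sq_nonneg _)
    (NNReal.coe_mono.comp (h.comp (uniformGrid_mono t₀ t n))) _

lemma measurable_ouVarianceSum {m : MeasurableSpace Ω} (ht : t₀ ≤ t)
    (hΛ : ∀ u ≤ t, Measurable[m] (Λ u)) (a : ℝ) (n : ℕ) :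
    Measurable[m] (ouVarianceSum a Λ t₀ t n) := by
  have h : ∀ k ≤ n + 1, Measurable[m] fun ω ↦ (Λ (uniformGrid t₀ t n k) ω : ℝ) := fun k hk ↦
    measurable_coe_nnreal_real.comp (hΛ _ (uniformGrid_mem_Icc ht hk).2)
  change Measurable[m] fun ω ↦ ∑ k ∈ Finset.range (n + 1),
    Real.exp (-a * ((t : ℝ) - uniformGrid t₀ t n (k + 1))) ^ 2 *
      ((Λ (uniformGrid t₀ t n (k + 1)) ω : ℝ) - Λ (uniformGrid t₀ t n k) ω)
  refine Finset.measurable_sum _ fun k hk ↦ ?_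
  have hk := Finset.mem_range.1 hk
  exact ((h (k + 1) (by omega)).sub (h k (by omega))).const_mul _

lemma ae_tendsto_ouVarianceSum (hΛ : IsSubordinator Λ P) (a : ℝ) (ht : t₀ ≤ t) :
    ∀ᵐ ω ∂P, Tendsto (fun n ↦ ouVarianceSum a Λ t₀ t n ω) atTop
      (𝓝 (ouVariance a Λ t₀ t ω)) := by
  filter_upwards [hΛ.monotone, hΛ.right_continuous] with ω hm hr
  exact tendsto_ouVarianceSum a (f := fun s ↦ (Λ s ω : ℝ)) (NNReal.coe_mono.comp hm)
    (fun s ↦ (NNReal.continuous_coe.continuousAt).comp_continuousWithinAt (hr s)) ht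

/-- The Riemann sums of the variation-of-constants formula along the uniform partitions. -/
noncomputable def ouSum (a : ℝ) (L : ℝ≥0 → Ω → ℝ) (t₀ t : ℝ≥0) (n : ℕ) (ω : Ω) : ℝ :=
  weightedIncr (fun k ↦ Real.exp (-a * ((t : ℝ) - uniformGrid t₀ t n (k + 1))))
    (uniformGrid t₀ t n) (n + 1) (fun s ↦ L s ω)

lemma ae_tendsto_ouSum {a : ℝ} {L : ℝ≥0 → Ω → ℝ} {y₀ : Ω → ℝ} {Y : ℝ≥0 → Ω → ℝ}
    (hY : IsOUSolution a L t₀ y₀ Y P) (ht : t₀ ≤ t) :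
    ∀ᵐ ω ∂P, Tendsto (fun n ↦ y₀ ω * Real.exp (-a * ((t : ℝ) - t₀)) + ouSum a L t₀ t n ω) atTop
      (𝓝 (Y t ω)) := by
  filter_upwards [hY.initial, hY.right_continuous, hY.left_limits, hY.equation] with ω h0 hr hl he
  have := (tendsto_ouSum a ht hr hl he).const_add (y₀ ω * Real.exp (-a * ((t : ℝ) - t₀)))
  rwa [h0, add_sub_cancel] at this

lemma setIntegral_cexp_ouSolution [IsProbabilityMeasure P]
    (hWm : ∀ t, Measurable (W t)) (hW : IsBrownianReal W P)
    (hΛ : IsSubordinator Λ P)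
    (hind : IndepFun (fun ω t ↦ W t ω) (fun ω t ↦ Λ t ω) P)
    (hℱ : IsNonanticipating ℱ W Λ P) {a : ℝ} (ht : t₀ ≤ t)
    {y₀ : Ω → ℝ} (hy₀ : Measurable[ℱ t₀] y₀)
    {Y : ℝ≥0 → Ω → ℝ} (hY : IsOUSolution a (timeChanged W Λ) t₀ y₀ Y P)
    {A B : Set Ω} (hA : MeasurableSet[ℱ t₀ ⊔ pastSigma Λ t₀] A)
    (hB : MeasurableSet[incrementSigma Λ t₀ t] B) (θ : ℝ) :
    ∫ ω in A ∩ B, cexp (θ * Y t ω * I) ∂P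
      = ∫ ω in A ∩ B, cexp ((θ * (y₀ ω * Real.exp (-a * ((t : ℝ) - t₀))) : ℝ) * I)
          * ((Real.exp (-(θ ^ 2 * ouVariance a Λ t₀ t ω) / 2) : ℝ) : ℂ) ∂P := by
  set ξ : Ω → ℝ := fun ω ↦ y₀ ω * Real.exp (-a * ((t : ℝ) - t₀)) with hξdef
  have hξ : Measurable[ℱ t₀] ξ := hy₀.mul_const _
  have hξm : Measurable ξ := hξ.mono (ℱ.le t₀) le_rfl
  have me1 : Continuous fun x : ℝ ↦ cexp ((x : ℂ) * I) := by fun_prop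
  have me2 : Continuous fun v : ℝ ↦ ((Real.exp (-(θ ^ 2 * v) / 2) : ℝ) : ℂ) := by fun_prop
  have hLm : ∀ s, AEMeasurable (timeChanged W Λ s) P :=
    aemeasurable_timeChanged hWm hW hΛ.measurable
  have lim1 : Tendsto (fun n ↦ ∫ ω in A ∩ B,
      cexp ((θ * (ξ ω + ouSum a (timeChanged W Λ) t₀ t n ω) : ℝ) * I) ∂P) atTop
      (𝓝 (∫ ω in A ∩ B, cexp ((θ * Y t ω : ℝ) * I) ∂P)) := by
    refine tendsto_integral_of_dominated_convergence (fun _ ↦ 1) (fun n ↦ ?_)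
      (integrable_const _) (fun n ↦ ae_of_all _ fun ω ↦ ?_) (ae_restrict_of_ae ?_)
    · exact (me1.measurable.comp_aemeasurable ((hξm.aemeasurable.add
        (aemeasurable_weightedIncr hLm _ _ _)).const_mul θ)).aestronglyMeasurable.restrict
    · rw [Complex.norm_exp_ofReal_mul_I]
    · filter_upwards [ae_tendsto_ouSum hY ht] with ω hω
      exact (me1.tendsto _).comp (hω.const_mul θ)
  have lim2 : Tendsto (fun n ↦ ∫ ω in A ∩ B, cexp ((θ * ξ ω : ℝ) * I)
      * ((Real.exp (-(θ ^ 2 * ouVarianceSum a Λ t₀ t n ω) / 2) : ℝ) : ℂ) ∂P) atTop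
      (𝓝 (∫ ω in A ∩ B, cexp ((θ * ξ ω : ℝ) * I)
          * ((Real.exp (-(θ ^ 2 * ouVariance a Λ t₀ t ω) / 2) : ℝ) : ℂ) ∂P)) := by
    refine tendsto_integral_of_dominated_convergence (fun _ ↦ 1) (fun n ↦ ?_)
      (integrable_const _) (fun n ↦ ae_restrict_of_ae ?_) (ae_restrict_of_ae ?_)
    · exact ((me1.measurable.comp (hξm.const_mul θ)).mul (me2.measurable.comp
        (measurable_ouVarianceSum ht (fun u _ ↦ hΛ.measurable u) a n))).aestronglyMeasurable
    · filter_upwards [hΛ.monotone] with ω hω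
      have := mul_nonneg (sq_nonneg θ) (ouVarianceSum_nonneg (t₀ := t₀) (t := t) a hω n)
      rw [norm_mul, Complex.norm_exp_ofReal_mul_I, one_mul, Complex.norm_real, Real.norm_eq_abs,
        Real.abs_exp]
      exact Real.exp_le_one_iff.2 (by linarith)
    · filter_upwards [ae_tendsto_ouVarianceSum hΛ a ht] with ω hω
      exact ((me2.tendsto _).comp hω).const_mul _
  simp_rw [← Complex.ofReal_mul θ]
  refine tendsto_nhds_unique lim1 (lim2.congr fun n ↦ ?_)
  -- The frequency `θ` is put into the weights, so that the squared weights produce `θ ^ 2` in the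
  -- variance.
  have := setIntegral_cexp_weightedIncr hWm hW hΛ.measurable hΛ.monotone hind hℱ
    (ξ := fun ω ↦ θ * ξ ω) ((hξ.mono le_sup_left le_rfl).const_mul θ) hA hB
    (fun k ↦ θ * Real.exp (-a * ((t : ℝ) - uniformGrid t₀ t n (k + 1))))
    (uniformGrid_mono t₀ t n) (le_uniformGrid t₀ t n) (n + 1)
  have e1 : ∀ ω, weightedIncr (fun k ↦ θ * Real.exp (-a * ((t : ℝ) - uniformGrid t₀ t n (k + 1))))
      (uniformGrid t₀ t n) (n + 1) (fun s ↦ timeChanged W Λ s ω)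
      = θ * ouSum a (timeChanged W Λ) t₀ t n ω := fun ω ↦ by
    simp only [ouSum, weightedIncr, Finset.mul_sum, mul_assoc]
  have e2 : ∀ ω, weightedIncr
      (fun k ↦ (θ * Real.exp (-a * ((t : ℝ) - uniformGrid t₀ t n (k + 1)))) ^ 2)
      (uniformGrid t₀ t n) (n + 1) (fun s ↦ (Λ s ω : ℝ))
      = θ ^ 2 * ouVarianceSum a Λ t₀ t n ω := fun ω ↦ by
    simp only [ouVarianceSum, weightedIncr, Finset.mul_sum, mul_pow, mul_assoc]
  simp only [e1, e2] at this
  refine this.symm.trans (integral_congr_ae (ae_of_all _ fun ω ↦ ?_))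
  simp only
  rw [← Complex.exp_add]
  congr 1
  push_cast
  ring

end CharFun

/-! ### The conditional law. -/

theorem mainTheorem1 {Ω : Type*} {mΩ : MeasurableSpace Ω} (P : Measure Ω) [IsProbabilityMeasure P]
    (ℱ : Filtration ℝ≥0 mΩ)
    (W : ℝ≥0 → Ω → ℝ) (hWm : ∀ t, Measurable (W t)) (hW : IsBrownianReal W P)
    (Λ : ℝ≥0 → Ω → ℝ≥0) (hΛ : IsSubordinator Λ P)
    (hind : IndepFun (fun ω t ↦ W t ω) (fun ω t ↦ Λ t ω) P)
    (hℱ : IsNonanticipating ℱ W Λ P)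
    (a : ℝ) (t₀ t : ℝ≥0) (ht : t₀ ≤ t)
    (y₀ : Ω → ℝ) (hy₀ : Measurable[ℱ t₀] y₀)
    (Y : ℝ≥0 → Ω → ℝ) (hY : IsOUSolution a (timeChanged W Λ) t₀ y₀ Y P) :
    IsCondLaw P (Y t) (ℱ t₀ ⊔ pastSigma Λ t)
      (fun ω ↦ gaussianReal (y₀ ω * Real.exp (-a * ((t : ℝ) - t₀)))
        (ouVariance a Λ t₀ t ω).toNNReal) := by
  have hle : ℱ t₀ ⊔ pastSigma Λ t ≤ mΩ :=
    sup_le (ℱ.le t₀) (pastSigma_le fun u _ ↦ hΛ.measurable u)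
  have hYm : AEMeasurable (Y t) P := by
    refine aemeasurable_of_tendsto_metrizable_ae' (fun n ↦ ?_) (ae_tendsto_ouSum hY ht)
    exact ((hy₀.mono (ℱ.le t₀) le_rfl).mul_const _).aemeasurable.add
      (aemeasurable_weightedIncr (aemeasurable_timeChanged hWm hW hΛ.measurable) _ _ _)
  refine ⟨hle, hYm, fun D hD ↦ ?_⟩
  -- `ouVariance` is obtained only as an almost sure limit of sums measurable for the conditioning
  -- σ-field. Their limsup is a version measurable for that σ-field everywhere.
  set V : Ω → ℝ := fun ω ↦ limsup (fun n ↦ ouVarianceSum a Λ t₀ t n ω) atTop with hV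
  have hVm : Measurable[ℱ t₀ ⊔ pastSigma Λ t] V := Measurable.limsup fun n ↦
    (measurable_ouVarianceSum ht (fun u hu ↦ measurable_pastSigma hu) a n).mono le_sup_right le_rfl
  have hVeq : ∀ᵐ ω ∂P, V ω = ouVariance a Λ t₀ t ω :=
    (ae_tendsto_ouVarianceSum hΛ a ht).mono fun ω hω ↦ hω.limsup_eq
  have hκm : Measurable[ℱ t₀ ⊔ pastSigma Λ t] fun ω ↦
      gaussianReal (y₀ ω * Real.exp (-a * ((t : ℝ) - t₀))) (V ω).toNNReal :=
    measurable_gaussianReal.comp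
      (((hy₀.mono le_sup_left le_rfl).mul_const _).prodMk hVm.real_toNNReal)
  have hκeq : (fun ω ↦ (gaussianReal (y₀ ω * Real.exp (-a * ((t : ℝ) - t₀)))
      (V ω).toNNReal).real D) =ᵐ[P] fun ω ↦ (gaussianReal
        (y₀ ω * Real.exp (-a * ((t : ℝ) - t₀))) (ouVariance a Λ t₀ t ω).toNNReal).real D :=
    hVeq.mono fun ω hω ↦ by simp only [hω]
  refine EventuallyEq.trans ?_ hκeq
  rw [sup_pastSigma_eq ht] at hle hκm ⊢
  refine condProb_ae_eq_of_charFun hYm hle hκm (fun A B hA hB θ ↦ ?_) hD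
  rw [setIntegral_cexp_ouSolution hWm hW hΛ hind hℱ ht hy₀ hY hA hB θ]
  refine integral_congr_ae (ae_restrict_of_ae (hVeq.mono fun ω hω ↦ ?_))
  have h0 : 0 ≤ ouVariance a Λ t₀ t ω := integral_nonneg fun _ ↦ (Real.exp_pos _).le
  simp only [hω, charFun_gaussianReal, Complex.ofReal_exp]
  rw [← Complex.exp_add, Real.coe_toNNReal _ h0]
  congr 1
  push_cast
  ring
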